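/- Let $\mathbb{F}_q$ be a finite field of characteristic at least $5$, let $A\in\mathbb{F}_q[t]$, and put $$\mathcal{A}=\tfrac13(A^2+3A+9),\qquad \mathcal{B}=-\tfrac1{27}(2A+3)(A^2+3A+9),\qquad f(Y)=Y^3-\mathcal{A}Y+\mathcal{B}.$$ (For $Y=x-\frac13A$ this is the Shanks polynomial $x^3-Ax^2-(A+3)x-1$.) Assume that $f$ is in standard form, i.e. there is no non-constant $Q\in\mathbb{F}_q[t]$ with $Q^2\mid\mathcal{A}$ and $Q^3\mid\mathcal{B}$. Let $K=\mathbb{F}_q(t)(\theta)$, where $\theta$ has minimal polynomial $f$ over $\mathbb{F}_q(t)$. Let $P\in\mathbb{F}_q[t]$ be an irreducible polynomial, and let $v_P$ denote the $P$-adic valuation. The $P$-signature of $K$ is the family, counted with multiplicity, of the pairs (ramification index, residue degree) of the places of $K$ (primes of the integral closure of $\mathbb{F}_q[t]$ in $K$) lying above $P$. Then the discriminant $D$ of $f$ is $D=(A^2+3A+9)^2$, and $K/\mathbb{F}_q(t)$ has $P$-signature * $(1,1;1,1;1,1)$ if and only if one of the following holds: * $v_P(\mathcal{A})=0<v_P(\mathcal{B})$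 and $\mathcal{A}$ is a square modulo $P$; * $v_P(\mathcal{A})=v_P(\mathcal{B})=0$, $v_P(D)$ is even, and the congruence $T^3-\mathcal{A}T+\mathcal{B}\equiv0\pmod P$ has exactly three solutions $T\in\mathbb{F}_q[t]$ modulo $P$; * $(1,3)$ if and only if $v_P(\mathcal{A})=v_P(\mathcal{B})=0$, $v_P(D)$ is even, and the congruence $T^3-\mathcal{A}T+\mathcal{B}\equiv0\pmod P$ has no solution $T\in\mathbb{F}_q[t]$; * $(3,1)$ if and only if $P\mid\mathcal{A}$ and $P\mid\mathcal{B}$. Moreover, for every irreducible $P$ one of these four conditions holds, so no other cases occur. -/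

import Mathlib

open scoped Polynomial

namespace ShanksCubic

variable {F : Type*} [Field F]

/-- The coefficient `𝒜 = (A² + 3A + 9) / 3`. -/
noncomputable def coeffA (A : F[X]) : F[X] :=
  Polynomial.C (1 / 3) * (A ^ 2 + 3 * A + 9)

/-- The coefficient `ℬ = -(2A + 3)(A² + 3A + 9) / 27`. -/
noncomputable def coeffB (A : F[X]) : F[X] :=
  -(Polynomial.C (1 / 27) * (2 * A + 3) * (A ^ 2 + 3 * A + 9))

/-- The cubic `f(Y) = Y³ - 𝒜 Y + ℬ` over `F[t]`. -/
noncomputable def stdCubic (A : F[X]) : F[X][X] :=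
  Polynomial.X ^ 3 - Polynomial.C (coeffA A) * Polynomial.X + Polynomial.C (coeffB A)

/-- `Y³ - aY + b` is in standard form: there is no non-constant polynomial `Q` with
`Q² ∣ a` and `Q³ ∣ b`. -/
def IsStandardForm (a b : F[X]) : Prop :=
  ¬ ∃ Q : F[X], 0 < Q.natDegree ∧ Q ^ 2 ∣ a ∧ Q ^ 3 ∣ b

/-- The extension `K` of `F(t)` has `P`-signature `m`: the places of `K` above the finite place
`P` of `F(t)`, that is the primes of the maximal order of `K` above `P`, are finite in number,
and `m` is the multiset of their pairs (ramification index, residue degree) over `P`.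
(A multiset of pairs is the same as the lexicographically sorted list of these pairs.) -/
def HasSignatureAt (K : Type*) [Field K] [Algebra F[X] K] (P : F[X])
    (m : Multiset (ℕ × ℕ)) : Prop :=
  ∃ s : Finset (Ideal (FunctionField.ringOfIntegers F K)),
    (s : Set (Ideal (FunctionField.ringOfIntegers F K))) =
        (Ideal.span {P}).primesOver (FunctionField.ringOfIntegers F K) ∧
      s.val.map (fun q => (q.ramificationIdx F[X], q.inertiaDeg F[X])) = m

/-- The set of residue classes `T` modulo `P` with `T³ - aT + b ≡ 0 (mod P)`. -/
def solutionsMod (P a b : F[X]) : Set (F[X] ⧸ Ideal.span {P}) :=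
  {T | T ^ 3 - Ideal.Quotient.mk (Ideal.span {P}) a * T
    + Ideal.Quotient.mk (Ideal.span {P}) b = 0}

end ShanksCubic

/-! Write M = A² + 3A + 9. Then 𝒜 = M/3, ℬ = -(2A+3)M/27 and D = M², all tied together by 4M -
(2A+3)² = 27. If P ∤ M, the order-three map x ↦ -1/(1+x) permutes the roots of the Shanks cubic
modulo P without fixed points, so there are no roots or three distinct ones. Three roots give three
primes above P; no root makes the reduction irreducible and forces residue degree 3. If P ∣ M, then
P ∤ 2A+3, so 𝒜 and ℬ have the same valuation n, and standard form gives n < 3. Comparing valuations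
in θ³ = 𝒜θ - ℬ then forces 3 ∣ e. Since ∑ e f = 3, each case fixes the whole signature
(`hasSignatureAt_cases`). The cases are exhaustive and their signatures distinct, which yields the
equivalences. -/

namespace ShanksCubic

/-! ### The order-three symmetry of the roots -/

section Field

variable {k : Type*} [Field k]

/-- A root of the depressed Shanks cubic with nonzero discriminant produces two further roots,
through the order-three substitution `x ↦ -1 / (1 + x)`. -/
theorem exists_three_roots {c α y : k} (hc : 3 * c = 1) (hM : α ^ 2 + 3 * α + 9 ≠ 0)
    (hy : y ^ 3 - c * (α ^ 2 + 3 * α + 9) * y +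
      -(c ^ 3 * (2 * α + 3) * (α ^ 2 + 3 * α + 9)) = 0) :
    ∃ y₂ y₃ : k, y ≠ y₂ ∧ y ≠ y₃ ∧ y₂ ≠ y₃ ∧
      ∀ z, z ^ 3 - c * (α ^ 2 + 3 * α + 9) * z +
        -(c ^ 3 * (2 * α + 3) * (α ^ 2 + 3 * α + 9)) = (z - y) * (z - y₂) * (z - y₃) := by
  have h3 : (3 : k) ≠ 0 := left_ne_zero_of_mul_eq_one hc
  obtain rfl : c = 1 / 3 := by field_simp; linear_combination hc
  obtain ⟨x, rfl⟩ : ∃ x, y = x - α / 3 := ⟨y + α / 3, by ring⟩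
  have hx : x ^ 3 - α * x ^ 2 - (α + 3) * x - 1 = 0 := by
    rw [← hy]; field_simp; ring
  have hx0 : x ≠ 0 := by rintro rfl; simp at hx
  have hx1 : 1 + x ≠ 0 := by
    intro h
    obtain rfl : x = -1 := by linear_combination h
    apply one_ne_zero (α := k); linear_combination hx
  have hα : α * (x * (x + 1)) = x ^ 3 - 3 * x - 1 := by linear_combination -hx
  -- A root of x² + x + 1 is a fixed point of the substitution; it would give α = 3x and hence M =
  -- 0.
  have hxx : x ^ 2 + x + 1 ≠ 0 := by
    intro h
    apply hM
    have : α = 3 * x := by linear_combination hx - (x - 1 - α) * h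
    rw [this]; linear_combination 9 * h
  have hα' : α = (x ^ 3 - 3 * x - 1) / (x * (1 + x)) := by
    rw [eq_div_iff (mul_ne_zero hx0 hx1)]; linear_combination hα
  -- The images of x under the substitution and its square, shifted back to the depressed variable.
  refine ⟨-1 / (1 + x) - α / 3, -(1 + x) / x - α / 3, ?_, ?_, ?_, ?_⟩
  · intro h
    have h' : x = -1 / (1 + x) := by linear_combination h
    rw [eq_div_iff hx1] at h'
    exact hxx (by linear_combination h')
  · intro h
    have h' : x = -(1 + x) / x := by linear_combination h
    rw [eq_div_iff hx0] at h'
    exact hxx (by linear_combination h')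
  · intro h
    have h' : -1 / (1 + x) = -(1 + x) / x := by linear_combination h
    rw [div_eq_div_iff hx1 hx0] at h'
    exact hxx (by linear_combination h')
  · intro z
    obtain ⟨w, rfl⟩ : ∃ w, z = w - α / 3 := ⟨z + α / 3, by ring⟩
    have : (w - x) * (w - -1 / (1 + x)) * (w - -(1 + x) / x) =
        w ^ 3 - α * w ^ 2 - (α + 3) * w - 1 := by
      rw [hα']; field_simp; ring
    rw [show ∀ u v : k, u - α / 3 - (v - α / 3) = u - v from fun u v => by ring,
      show ∀ u v : k, u - α / 3 - (v - α / 3) = u - v from fun u v => by ring,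
      show ∀ u v : k, u - α / 3 - (v - α / 3) = u - v from fun u v => by ring, this]
    field_simp
    ring

end Field

/-! ### Signatures forced by ∑ e f = 3 -/

section Primes

variable {R S : Type*} [CommRing R] [CommRing S] [Algebra R S]

theorem sum_ramificationIdx_mul_inertiaDeg [IsDomain R] [Module.Finite R S] [Module.Flat R S]
    {p : Ideal R} [p.IsPrime] {s : Finset (Ideal S)} (hs : (s : Set (Ideal S)) = p.primesOver S) :
    ∑ q ∈ s, q.ramificationIdx R * q.inertiaDeg R = Module.finrank R S := by
  have : Fintype (p.primesOver S) := Fintype.ofFinset s fun q => by rw [← hs]; simp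
  rw [← Ideal.sum_ramification_inertia_eq_finrank p S]
  refine Finset.sum_subtype s (fun q => ?_) _
  rw [← hs]; simp

variable {s : Finset (Ideal S)} {e f : Ideal S → ℕ}

theorem map_pair_eq_of_three_le_card (hsum : ∑ q ∈ s, e q * f q = 3)
    (he : ∀ q ∈ s, 0 < e q) (hf : ∀ q ∈ s, 0 < f q) (hcard : 3 ≤ s.card) :
    s.val.map (fun q => (e q, f q)) = {(1, 1), (1, 1), (1, 1)} := by
  have h1 : ∀ q ∈ s, 1 ≤ e q * f q := fun q hq => Nat.mul_pos (he q hq) (hf q hq)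
  have hle : ∑ _q ∈ s, 1 ≤ ∑ q ∈ s, e q * f q := Finset.sum_le_sum h1
  have hcard' : s.card = 3 := by simp at hle; omega
  have heq : ∀ q ∈ s, 1 = e q * f q :=
    (Finset.sum_eq_sum_iff_of_le h1).1 (by simp [hsum, hcard'])
  have : s.val.map (fun q => (e q, f q)) = s.val.map (fun _ => (1, 1)) := by
    refine Multiset.map_congr rfl fun q hq => ?_
    obtain ⟨h₁, h₂⟩ := mul_eq_one.1 (heq q hq).symm
    rw [h₁, h₂]
  rw [this, Multiset.map_const', Finset.card_val, hcard']
  rfl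

theorem map_pair_eq_of_three_le_mul (hsum : ∑ q ∈ s, e q * f q = 3)
    (he : ∀ q ∈ s, 0 < e q) (hf : ∀ q ∈ s, 0 < f q) {q : Ideal S} (hq : q ∈ s)
    (h3 : 3 ≤ e q * f q) :
    e q * f q = 3 ∧ s.val.map (fun q => (e q, f q)) = {(e q, f q)} := by
  rw [← Finset.add_sum_erase s _ hq] at hsum
  have h0 : ∑ x ∈ s.erase q, e x * f x = 0 := by omega
  have hs : s = {q} := by
    refine Finset.eq_singleton_iff_unique_mem.2 ⟨hq, fun x hx => ?_⟩
    by_contra hne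
    have := Finset.sum_eq_zero_iff.1 h0 x (Finset.mem_erase.2 ⟨hne, hx⟩)
    exact (Nat.mul_pos (he x hx) (hf x hx)).ne' this
  refine ⟨by omega, ?_⟩
  subst hs
  simp

end Primes

/-! ### Primes obtained from roots and from irreducibility modulo p -/

section Lying

variable {R S : Type*} [CommRing R] [IsDomain R] [IsIntegrallyClosed R] [CommRing S] [IsDomain S]
  [Algebra R S] [Module.IsTorsionFree R S] [Algebra.IsIntegral R S]

/-- A root `r` of the minimal polynomial of `x` modulo a maximal ideal `p` gives a prime above
`p` containing `x - r`. -/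
theorem exists_mem_primesOver_sub_mem (x : S) (p : Ideal R) [hp : p.IsMaximal] (r : R)
    (hr : (minpoly R x).eval r ∈ p) :
    ∃ q ∈ p.primesOver S, x - algebraMap R S r ∈ q := by
  let g := minpoly R x
  have hx : IsIntegral R x := Algebra.IsIntegral.isIntegral x
  -- As R is integrally closed, R[x] is `AdjoinRoot g`, so x ↦ r defines a map R[x] → R/p. Its
  -- kernel is a prime over p containing x - r, and lying-over lifts it to S.
  let φ : AdjoinRoot g →+* R ⧸ p :=
    AdjoinRoot.lift (Ideal.Quotient.mk p) (Ideal.Quotient.mk p r) (by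
      rw [Polynomial.eval₂_at_apply]; exact Ideal.Quotient.eq_zero_iff_mem.2 hr)
  let ι := minpoly.equivAdjoin hx
  let x' : Algebra.adjoin R {x} := ⟨x, Algebra.self_mem_adjoin_singleton R x⟩
  let χ : Algebra.adjoin R {x} →+* R ⧸ p := φ.comp (ι.symm : _ →+* AdjoinRoot g)
  have hχx : χ x' = Ideal.Quotient.mk p r := by
    have : ι.symm x' = AdjoinRoot.root g := by
      rw [AlgEquiv.symm_apply_eq]
      ext
      simp [ι, x', AdjoinRoot.Minpoly.toAdjoin, g]
    change φ (ι.symm x') = _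
    rw [this]
    exact AdjoinRoot.lift_root _
  have hχa (a : R) : χ (algebraMap R _ a) = Ideal.Quotient.mk p a := by
    change φ (ι.symm (algebraMap R _ a)) = _
    rw [AlgEquiv.commutes]
    exact AdjoinRoot.lift_of _
  have hprime : (RingHom.ker χ).IsPrime := RingHom.ker_isPrime χ
  have : Algebra.IsIntegral (Algebra.adjoin R {x}) S := Algebra.IsIntegral.tower_top R
  obtain ⟨q, -, hq, hqc⟩ := Ideal.exists_ideal_over_prime_of_isIntegral
    (RingHom.ker χ) (⊥ : Ideal S) (by
      rw [← RingHom.ker_eq_comap_bot, (RingHom.injective_iff_ker_eq_bot _).1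
        (FaithfulSMul.algebraMap_injective (Algebra.adjoin R {x}) S)]
      exact bot_le)
  have hmem (y : Algebra.adjoin R {x}) : (y : S) ∈ q ↔ χ y = 0 := by
    rw [← RingHom.mem_ker, ← hqc]; rfl
  refine ⟨q, ⟨hq, ⟨?_⟩⟩, ?_⟩
  · ext a
    rw [Ideal.under_def, Ideal.mem_comap, IsScalarTower.algebraMap_apply R (Algebra.adjoin R {x}) S]
    refine Iff.trans ?_ (hmem _).symm
    rw [hχa, Ideal.Quotient.eq_zero_iff_mem]
  · have := (hmem (x' - algebraMap R _ r)).2 (by rw [map_sub, hχx, hχa, sub_self])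
    simpa [x'] using this

end Lying

/-- If the minimal polynomial of `x` is irreducible modulo `p`, its degree bounds the inertia
degree of every prime above `p` from below. -/
theorem natDegree_minpoly_le_inertiaDeg {R S : Type*} [CommRing R] [CommRing S] [Algebra R S]
    [Module.Finite R S] (x : S) (p : Ideal R) [p.IsMaximal]
    (h : Irreducible ((minpoly R x).map (Ideal.Quotient.mk p))) {q : Ideal S}
    (hq : q ∈ p.primesOver S) : (minpoly R x).natDegree ≤ q.inertiaDeg R := by
  have hx : IsIntegral R x := Algebra.IsIntegral.isIntegral x
  have : q.IsPrime := hq.1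
  have : q.LiesOver p := hq.2
  have : q.IsMaximal := Ideal.IsMaximal.of_liesOver_isMaximal q p
  let : Field (R ⧸ p) := Ideal.Quotient.field p
  let : Field (S ⧸ q) := Ideal.Quotient.field q
  rw [Ideal.inertiaDeg_eq_of_isMaximal p q]
  have hmonic := (minpoly.monic hx).map (Ideal.Quotient.mk p)
  -- The reduction is the minimal polynomial of the image of x, so its degree is at most [S/q :
  -- R/p].
  have hmin : (minpoly R x).map (Ideal.Quotient.mk p) =
      minpoly (R ⧸ p) (Ideal.Quotient.mk q x) := by
    refine minpoly.eq_of_irreducible_of_monic h ?_ hmonic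
    rw [Polynomial.aeval_def, Polynomial.eval₂_map,
      show (algebraMap (R ⧸ p) (S ⧸ q)).comp (Ideal.Quotient.mk p) =
        (Ideal.Quotient.mk q).comp (algebraMap R S) from rfl,
      ← Polynomial.hom_eval₂, ← Polynomial.aeval_def, minpoly.aeval, map_zero]
  rw [← (minpoly.monic hx).natDegree_map (Ideal.Quotient.mk p), hmin]
  exact minpoly.natDegree_le _

end ShanksCubic

namespace ShanksCubic

/-! ### Ramification from a Newton polygon argument -/

section Ramified

variable {R S : Type*} [CommRing R] [IsDedekindDomain R] [CommRing S] [IsDedekindDomain S]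
  [Algebra R S] [FaithfulSMul R S]

/-- If `x³ = ax - b` with `a` and `b` of equal valuation `n` at `p`, where `0 < n` and `3 ∤ n`, then
`3` divides the ramification index of every prime above `p`. -/
theorem three_dvd_ramificationIdx {x : S} {a b : R} {p : Ideal R} (hp : p ≠ ⊥) [p.IsPrime]
    (hx : x ^ 3 = algebraMap R S a * x - algebraMap R S b) {n : ℕ} (hn0 : n ≠ 0) (hn : ¬ 3 ∣ n)
    (ha : emultiplicity p (Ideal.span {a}) = n) (hb : emultiplicity p (Ideal.span {b}) = n)
    {q : Ideal S} (hq : q ∈ p.primesOver S) : 3 ∣ q.ramificationIdx R := by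
  have : q.IsPrime := hq.1
  have : q.LiesOver p := hq.2
  have hpirr : Irreducible p := (Ideal.prime_of_isPrime hp inferInstance).irreducible
  have hq0 : q ≠ ⊥ := Ideal.ne_bot_of_liesOver_of_ne_bot hp q
  have hqp : Prime q := Ideal.prime_of_isPrime hq0 inferInstance
  have hval (c : R) (hc : emultiplicity p (Ideal.span {c}) = n) :
      emultiplicity q (Ideal.span {algebraMap R S c}) = (q.ramificationIdx R * n : ℕ) := by
    have hc0 : Ideal.span {c} ≠ ⊥ := by
      intro h
      rw [h, ← Ideal.zero_eq_bot, emultiplicity_zero] at hc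
      exact ENat.top_ne_natCast n hc
    have := Ideal.IsDedekindDomain.emultiplicity_map_eq_ramificationIdx'_mul (v := p) (w := q)
      hc0 hpirr hqp.irreducible hq0
    rw [Ideal.map_span, Set.image_singleton, hc,
      Ideal.ramificationIdx'_eq_ramificationIdx p q hp] at this
    exact_mod_cast this
  have hva := hval a ha
  have hvb := hval b hb
  set m := q.ramificationIdx R * n with hm
  have hmem (y : S) (k : ℕ) : q ^ k ∣ Ideal.span {y} ↔ y ∈ q ^ k := by
    rw [Ideal.dvd_span_singleton]
  rw [emultiplicity_eq_coe, hmem, hmem] at hva hvb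
  have hne : m ≠ 0 := by
    intro h0
    have haq : a ∈ p := by
      have : p ∣ Ideal.span {a} := by
        apply dvd_of_emultiplicity_pos
        rw [ha]; exact_mod_cast Nat.pos_of_ne_zero hn0
      rwa [Ideal.dvd_span_singleton] at this
    refine hva.2 ?_
    rw [h0, zero_add, pow_one]
    rwa [Ideal.over_def q p] at haq
  have hxq : x ∈ q := by
    have h1 := Ideal.pow_le_self hne hva.1
    have h2 := Ideal.pow_le_self hne hvb.1
    refine Ideal.IsPrime.mem_of_pow_mem inferInstance 3 ?_
    rw [hx]
    exact q.sub_mem (q.mul_mem_right _ h1) h2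
  have hax : algebraMap R S a * x ∈ q ^ (m + 1) := by
    rw [pow_succ]; exact Ideal.mul_mem_mul hva.1 hxq
  -- Since x ∈ q, the term ax has valuation above m, so b alone determines the valuation of x³.
  -- Hence 3 v(x) = e n.
  have hx3 : emultiplicity q (Ideal.span {x ^ 3}) = m := by
    rw [emultiplicity_eq_coe, hmem, hmem, hx]
    refine ⟨Ideal.sub_mem _ (Ideal.pow_le_pow_right m.le_succ hax) hvb.1, fun h => hvb.2 ?_⟩
    simpa using Ideal.sub_mem _ hax h
  rw [← Ideal.span_singleton_pow, emultiplicity_pow hqp] at hx3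
  have h3 : 3 ∣ m := by
    cases hk : emultiplicity q (Ideal.span {x}) with
    | top => rw [hk] at hx3; simp at hx3
    | coe k => rw [hk] at hx3; exact ⟨k, by exact_mod_cast hx3.symm⟩
  exact (Nat.prime_three.dvd_mul.1 h3).resolve_right hn

end Ramified

/-! ### Discriminant and valuations of the coefficients -/

section Coefficients

variable {F : Type*} [Field F]

open Polynomial

theorem three_mul_C_one_third (h3 : (3 : F) ≠ 0) : 3 * (C (1 / 3) : F[X]) = 1 := by
  rw [show (3 : F[X]) = C 3 from rfl, ← C_mul, mul_one_div_cancel h3, C_1]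

theorem coeffB_eq (A : F[X]) :
    coeffB A = -(C (1 / 3) ^ 3 * (2 * A + 3) * (A ^ 2 + 3 * A + 9)) := by
  rw [coeffB, ← C_pow]; norm_num

theorem natDegree_stdCubic (A : F[X]) : (stdCubic A).natDegree = 3 := by
  rw [stdCubic]; compute_degree!

theorem stdCubic_monic (A : F[X]) : (stdCubic A).Monic := by
  rw [stdCubic]; monicity!

theorem discr_stdCubic (h3 : (3 : F) ≠ 0) (A : F[X]) :
    (stdCubic A).discr = (A ^ 2 + 3 * A + 9) ^ 2 := by
  rw [discr_of_degree_eq_three (by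
    rw [degree_eq_natDegree (stdCubic_monic A).ne_zero, natDegree_stdCubic]; rfl)]
  have h0 : (stdCubic A).coeff 0 = coeffB A := by simp [stdCubic]
  have h1 : (stdCubic A).coeff 1 = -coeffA A := by simp [stdCubic, coeff_C]
  have h2 : (stdCubic A).coeff 2 = 0 := by simp [stdCubic]
  have h4 : (stdCubic A).coeff 3 = 1 := by simp [stdCubic]
  have hc := three_mul_C_one_third h3
  have hc3 : 27 * (C (1 / 3) : F[X]) ^ 3 = 1 := by
    rw [show (27 : F[X]) * C (1 / 3) ^ 3 = (3 * C (1 / 3)) ^ 3 by ring, hc, one_pow]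
  rw [h0, h1, h2, h4, coeffB_eq, coeffA]
  generalize (C (1 / 3) : F[X]) = c at *
  -- This is (4M - (2A+3)²)/27 = 1, the cofactor of M² in 4𝒜³ - 27ℬ².
  have h12 : 4 * c ^ 3 * (A ^ 2 + 3 * A + 9) - 27 * c ^ 3 * c ^ 3 * (2 * A + 3) ^ 2 = 1 := by
    rw [hc3]; linear_combination hc3
  linear_combination (A ^ 2 + 3 * A + 9) ^ 2 * h12

theorem isUnit_C_one_third (h3 : (3 : F) ≠ 0) : IsUnit (C (1 / 3) : F[X]) :=
  isUnit_C.2 (by simpa using h3)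

variable {P A : F[X]}

theorem dvd_coeffA_iff (h3 : (3 : F) ≠ 0) {Q : F[X]} : Q ∣ coeffA A ↔ Q ∣ A ^ 2 + 3 * A + 9 :=
  (isUnit_C_one_third h3).dvd_mul_left

theorem dvd_coeffB {Q : F[X]} (h : Q ∣ A ^ 2 + 3 * A + 9) : Q ∣ coeffB A := by
  rw [coeffB_eq]; exact (h.mul_left _).neg_right

theorem not_dvd_two_mul_add_three (h3 : (3 : F) ≠ 0) (hP : Irreducible P)
    (h : P ∣ A ^ 2 + 3 * A + 9) : ¬ P ∣ 2 * A + 3 := by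
  intro h'
  have : P ∣ C 27 := by
    have h27 : (C 27 : F[X]) = 4 * (A ^ 2 + 3 * A + 9) - (2 * A + 3) * (2 * A + 3) := by
      rw [show (C 27 : F[X]) = 27 from rfl]; ring
    rw [h27]
    exact dvd_sub (h.mul_left _) (h'.mul_left _)
  refine hP.not_isUnit (isUnit_of_dvd_unit this (isUnit_C.2 ?_))
  rw [show (27 : F) = 3 ^ 3 by norm_num]
  exact (pow_ne_zero 3 h3).isUnit

/-- Both valuations equal v_P(M), as P ∤ 2A+3. It is 1 or 2, because P³ ∣ M would violate standard
form with Q = P. -/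
theorem exists_emultiplicity_eq (h3 : (3 : F) ≠ 0) (hstd : IsStandardForm (coeffA A) (coeffB A))
    (hP : Irreducible P) (h : P ∣ A ^ 2 + 3 * A + 9) :
    ∃ n : ℕ, n ≠ 0 ∧ ¬ 3 ∣ n ∧ emultiplicity P (coeffA A) = n ∧
      emultiplicity P (coeffB A) = n := by
  have hcube : ¬ P ^ 3 ∣ A ^ 2 + 3 * A + 9 := fun h' =>
    hstd ⟨P, hP.natDegree_pos, (dvd_coeffA_iff h3).2 ((pow_dvd_pow P (by norm_num)).trans h'),
      dvd_coeffB h'⟩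
  have hfin : FiniteMultiplicity P (A ^ 2 + 3 * A + 9) := ⟨2, hcube⟩
  have hlt : multiplicity P (A ^ 2 + 3 * A + 9) < 3 :=
    hfin.multiplicity_lt_iff_not_dvd.2 hcube
  have hpos : multiplicity P (A ^ 2 + 3 * A + 9) ≠ 0 := multiplicity_ne_zero.2 h
  have hc := (isUnit_C_one_third h3)
  have hunit : emultiplicity P (C (1 / 3) : F[X]) = 0 :=
    emultiplicity_eq_zero.2 fun h => hP.not_isUnit (isUnit_of_dvd_unit h hc)
  refine ⟨multiplicity P (A ^ 2 + 3 * A + 9), hpos, by omega, ?_, ?_⟩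
  · rw [coeffA, emultiplicity_mul hP.prime, hunit, zero_add, hfin.emultiplicity_eq_multiplicity]
  · rw [coeffB_eq, emultiplicity_neg, emultiplicity_mul hP.prime, emultiplicity_mul hP.prime,
      emultiplicity_pow hP.prime, hunit,
      emultiplicity_eq_zero.2 (not_dvd_two_mul_add_three h3 hP h), mul_zero, zero_add, zero_add,
      hfin.emultiplicity_eq_multiplicity]

end Coefficients

end ShanksCubic

namespace ShanksCubic

/-! ### Solutions of the cubic congruence -/

section Solutions

variable {F : Type*} [Field F] {P A : F[X]}

open Polynomial

theorem solutionsMod_eq_of_mem (h3 : (3 : F) ≠ 0) (hP : Irreducible P)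
    (hM : ¬ P ∣ A ^ 2 + 3 * A + 9) {T : F[X] ⧸ Ideal.span {P}}
    (hT : T ∈ solutionsMod P (coeffA A) (coeffB A)) :
    ∃ T₂ T₃, T ≠ T₂ ∧ T ≠ T₃ ∧ T₂ ≠ T₃ ∧
      solutionsMod P (coeffA A) (coeffB A) = {T, T₂, T₃} := by
  have : (Ideal.span {P}).IsMaximal := PrincipalIdealRing.isMaximal_of_irreducible hP
  let : Field (F[X] ⧸ Ideal.span {P}) := Ideal.Quotient.field _
  let π := Ideal.Quotient.mk (Ideal.span {P})
  have hc : 3 * π (C (1 / 3)) = 1 := by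
    have := congrArg π (three_mul_C_one_third h3)
    rwa [map_mul, map_ofNat, map_one] at this
  have hM' : (π A) ^ 2 + 3 * π A + 9 ≠ 0 := by
    intro h
    apply hM
    rw [← Ideal.mem_span_singleton, ← Ideal.Quotient.eq_zero_iff_mem, ← h]
    simp only [map_mul, map_add, map_pow, map_ofNat, π]
  have hmem (z : F[X] ⧸ Ideal.span {P}) : z ∈ solutionsMod P (coeffA A) (coeffB A) ↔
      z ^ 3 - π (C (1 / 3)) * (π A ^ 2 + 3 * π A + 9) * z +
        -(π (C (1 / 3)) ^ 3 * (2 * π A + 3) * (π A ^ 2 + 3 * π A + 9)) = 0 := by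
    rw [solutionsMod, Set.mem_ofPred, coeffB_eq, coeffA]
    simp only [map_mul, map_add, map_neg, map_pow, map_ofNat, π]
  obtain ⟨T₂, T₃, h₁, h₂, h₃, hfac⟩ := exists_three_roots hc hM' ((hmem T).1 hT)
  refine ⟨T₂, T₃, h₁, h₂, h₃, ?_⟩
  ext z
  rw [hmem, hfac, mul_eq_zero, mul_eq_zero, sub_eq_zero, sub_eq_zero, sub_eq_zero, or_assoc]
  rfl

theorem eval_stdCubic_mem_iff {r : F[X]} :
    (stdCubic A).eval r ∈ Ideal.span {P} ↔
      Ideal.Quotient.mk (Ideal.span {P}) r ∈ solutionsMod P (coeffA A) (coeffB A) := by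
  rw [← Ideal.Quotient.eq_zero_iff_mem, solutionsMod, Set.mem_ofPred, stdCubic]
  simp

/-- Here P ∣ 2A+3, so 4M ≡ 27 and 𝒜 ≡ 9/4 = (3/2)²: the square condition in the first split case is
automatic. -/
theorem exists_dvd_sq_sub_coeffA (h2 : (2 : F) ≠ 0) (h3 : (3 : F) ≠ 0) (hP : Irreducible P)
    (hM : ¬ P ∣ A ^ 2 + 3 * A + 9) (hb : P ∣ coeffB A) : ∃ S : F[X], P ∣ S ^ 2 - coeffA A := by
  have hc := three_mul_C_one_third h3
  have hd : 2 * (C (1 / 2) : F[X]) = 1 := by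
    rw [show (2 : F[X]) = C 2 from rfl, ← C_mul, mul_one_div_cancel h2, C_1]
  have hu : ¬ P ∣ C (1 / 3) ^ 3 := fun h =>
    hP.not_isUnit (isUnit_of_dvd_unit h ((isUnit_C_one_third h3).pow 3))
  rw [coeffB_eq, dvd_neg, hP.prime.dvd_mul, hP.prime.dvd_mul] at hb
  have h23 : P ∣ 2 * A + 3 := (hb.resolve_right hM).resolve_left hu
  refine ⟨3 * C (1 / 2), ?_⟩
  rw [coeffA]
  generalize (C (1 / 3) : F[X]) = c at *
  generalize (C (1 / 2) : F[X]) = d at *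
  have : (3 * d) ^ 2 - c * (A ^ 2 + 3 * A + 9) = (2 * A + 3) * (-(c * d ^ 2 * (2 * A + 3))) := by
    linear_combination c * (A ^ 2 + 3 * A + 9) * (2 * d + 1) * hd - 9 * d ^ 2 * hc
  rw [this]
  exact h23.mul_right _

end Solutions

/-! ### The signature in each case -/

section Signature

variable {F : Type*} [Field F] {K : Type*} [Field K] [Algebra F[X] K] {P : F[X]}

theorem HasSignatureAt.unique {m m' : Multiset (ℕ × ℕ)} (h : HasSignatureAt K P m)
    (h' : HasSignatureAt K P m') : m = m' := by
  obtain ⟨s, hs, rfl⟩ := h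
  obtain ⟨s', hs', rfl⟩ := h'
  rw [Finset.coe_injective (hs.trans hs'.symm)]

variable [Algebra (RatFunc F) K] [IsScalarTower F[X] (RatFunc F) K] {A : F[X]} {θ : K}

open Polynomial

omit [Algebra F[X] K] [IsScalarTower F[X] (RatFunc F) K] in
theorem functionField_of_minpoly (hgen : IntermediateField.adjoin (RatFunc F) {θ} = ⊤)
    (hmin : minpoly (RatFunc F) θ = (stdCubic A).map (algebraMap F[X] (RatFunc F))) :
    FunctionField F K ∧ Module.finrank (RatFunc F) K = 3 := by
  have hdeg : (minpoly (RatFunc F) θ).natDegree = 3 := by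
    rw [hmin, (stdCubic_monic A).natDegree_map, natDegree_stdCubic]
  have hint : IsIntegral (RatFunc F) θ := by
    by_contra h
    rw [minpoly.eq_zero h] at hdeg
    simp at hdeg
  have hfin := IntermediateField.adjoin.finrank hint
  rw [hgen, IntermediateField.finrank_top', hdeg] at hfin
  exact ⟨FiniteDimensional.of_finrank_pos (by omega), hfin⟩

-- Separability makes the integral closure finite over F[X]. It holds because the derivative of the
-- cubic has leading coefficient 3 ≠ 0.
omit [Algebra F[X] K] [IsScalarTower F[X] (RatFunc F) K] in
theorem isSeparable_of_minpoly (h3 : (3 : F) ≠ 0)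
    (hgen : IntermediateField.adjoin (RatFunc F) {θ} = ⊤)
    (hmin : minpoly (RatFunc F) θ = (stdCubic A).map (algebraMap F[X] (RatFunc F))) :
    Algebra.IsSeparable (RatFunc F) K := by
  have := (functionField_of_minpoly hgen hmin).1
  have hint : IsIntegral (RatFunc F) θ := Algebra.IsIntegral.isIntegral θ
  have hsep : IsSeparable (RatFunc F) θ := by
    refine (separable_iff_derivative_ne_zero (minpoly.irreducible hint)).2 fun h => ?_
    have hcoeff := congrArg (fun p => p.coeff 2) h
    simp only [hmin, coeff_derivative, coeff_map] at hcoeff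
    have h4 : (stdCubic A).coeff 3 = 1 := by simp [stdCubic]
    rw [h4] at hcoeff
    have h30 : algebraMap F (RatFunc F) 3 = 0 := by
      rw [map_ofNat]
      simp only [map_one, one_mul, coeff_zero] at hcoeff
      rw [← hcoeff]; norm_num
    exact h3 ((map_eq_zero _).1 h30)
  have := (IntermediateField.isSeparable_adjoin_simple_iff_isSeparable _ _).2 hsep
  rw [hgen] at this
  exact AlgEquiv.Algebra.isSeparable IntermediateField.topEquiv

variable (K) in
theorem hasSignatureAt_cases (h3 : (3 : F) ≠ 0)
    (hstd : IsStandardForm (coeffA A) (coeffB A))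
    (hgen : IntermediateField.adjoin (RatFunc F) {θ} = ⊤)
    (hmin : minpoly (RatFunc F) θ = (stdCubic A).map (algebraMap F[X] (RatFunc F)))
    (hP : Irreducible P) :
    (P ∣ A ^ 2 + 3 * A + 9 → HasSignatureAt K P {(3, 1)}) ∧
    (¬ P ∣ A ^ 2 + 3 * A + 9 → (solutionsMod P (coeffA A) (coeffB A)).Nonempty →
      HasSignatureAt K P {(1, 1), (1, 1), (1, 1)}) ∧
    (solutionsMod P (coeffA A) (coeffB A) = ∅ → HasSignatureAt K P {(1, 3)}) := by
  obtain ⟨_, hrank⟩ := functionField_of_minpoly hgen hmin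
  have := isSeparable_of_minpoly h3 hgen hmin
  let B := FunctionField.ringOfIntegers F K
  have : Module.Finite F[X] B := inferInstance
  have : FaithfulSMul F[X] B := (faithfulSMul_iff_algebraMap_injective _ _).2
    (FunctionField.ringOfIntegers.algebraMap_injective F K)
  have : Module.IsTorsionFree F[X] B := inferInstance
  have : Module.Flat F[X] B := inferInstance
  have hrankB : Module.finrank F[X] B = 3 := by
    rw [← hrank]; exact (IsFractionRing.finrank_eq F[X] (RatFunc F) B K).symm
  have hmonic := stdCubic_monic A
  have hroot : aeval θ (stdCubic A) = 0 := by
    have := minpoly.aeval (RatFunc F) θ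
    rwa [hmin, aeval_map_algebraMap] at this
  let x : B := ⟨θ, stdCubic A, hmonic, hroot⟩
  have hminx : minpoly F[X] x = stdCubic A := by
    have h := minpoly.isIntegrallyClosed_eq_field_fractions (RatFunc F) K
      (Algebra.IsIntegral.isIntegral (R := F[X]) x)
    exact (map_injective _ (IsFractionRing.injective F[X] (RatFunc F))
      (hmin.symm.trans h)).symm
  set p : Ideal F[X] := Ideal.span {P} with hp
  have hp0 : p ≠ ⊥ := by rw [hp, Ne, Ideal.span_singleton_eq_bot]; exact hP.ne_zero
  have hpmax : p.IsMaximal := PrincipalIdealRing.isMaximal_of_irreducible hP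
  obtain ⟨s, hs⟩ : ∃ s : Finset (Ideal B), (s : Set (Ideal B)) = p.primesOver B :=
    ⟨(IsDedekindDomain.primesOver_finite p B).toFinset, Set.Finite.coe_toFinset _⟩
  have hmem (q : Ideal B) : q ∈ s ↔ q ∈ p.primesOver B := by rw [← hs]; simp
  have hsum := (sum_ramificationIdx_mul_inertiaDeg hs).trans hrankB
  have he (q) (hq : q ∈ s) : 0 < q.ramificationIdx F[X] :=
    have := ((hmem q).1 hq).1
    q.ramificationIdx_pos F[X]
  have hf (q) (hq : q ∈ s) : 0 < q.inertiaDeg F[X] :=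
    have := ((hmem q).1 hq).1
    q.inertiaDeg_pos F[X]
  have hsne : s.Nonempty := by
    rw [Finset.nonempty_iff_ne_empty]; rintro rfl; simp at hsum
  obtain ⟨q, hq⟩ := hsne
  refine ⟨fun hPM => ⟨s, hs, ?_⟩, fun hPM hne => ⟨s, hs, ?_⟩, fun hempty => ⟨s, hs, ?_⟩⟩
  · obtain ⟨n, hn0, hn, ha, hb⟩ := exists_emultiplicity_eq h3 hstd hP hPM
    have hspan (c : F[X]) : emultiplicity p (Ideal.span {c}) = emultiplicity P c :=
      emultiplicity_eq_emultiplicity_iff.2 fun k => by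
        rw [hp, Ideal.span_singleton_pow, Ideal.dvd_span_singleton, Ideal.mem_span_singleton]
    have hx3 : x ^ 3 = algebraMap F[X] B (coeffA A) * x - algebraMap F[X] B (coeffB A) := by
      have := minpoly.aeval F[X] x
      rw [hminx, stdCubic] at this
      simp only [map_add, map_sub, map_mul, map_pow, aeval_X, aeval_C] at this
      linear_combination this
    have hdvd := three_dvd_ramificationIdx hp0 hx3 hn0 hn ((hspan _).trans ha)
      ((hspan _).trans hb) ((hmem q).1 hq)
    have h3e := Nat.le_of_dvd (he q hq) hdvd
    obtain ⟨h1, h2⟩ := map_pair_eq_of_three_le_mul hsum he hf hq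
      (h3e.trans (Nat.le_mul_of_pos_right _ (hf q hq)))
    have hf1 : q.inertiaDeg F[X] = 1 := by
      have := hf q hq
      nlinarith
    rw [h2, hf1, show q.ramificationIdx F[X] = 3 by simpa [hf1] using h1]
  · refine map_pair_eq_of_three_le_card hsum he hf ?_
    obtain ⟨T₁, hT₁⟩ := hne
    obtain ⟨T₂, T₃, h₁, h₂, h₃, hsol⟩ := solutionsMod_eq_of_mem h3 hP hPM hT₁
    have hex (T) (hT : T ∈ solutionsMod P (coeffA A) (coeffB A)) :
        ∃ r : F[X], Ideal.Quotient.mk p r = T ∧ ∃ q ∈ s, x - algebraMap F[X] B r ∈ q := by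
      obtain ⟨r, rfl⟩ := Ideal.Quotient.mk_surjective T
      obtain ⟨q, hq, hxq⟩ := exists_mem_primesOver_sub_mem x p r
        (by rw [hminx]; exact eval_stdCubic_mem_iff.2 hT)
      exact ⟨r, rfl, q, (hmem q).2 hq, hxq⟩
    -- A common prime would contain r - r', which would then lie in q ∩ F[X] = p.
    have hne {r r' : F[X]} {q q' : Ideal B} (hr : Ideal.Quotient.mk p r ≠ Ideal.Quotient.mk p r')
        (hq : q ∈ s) (h : x - algebraMap F[X] B r ∈ q) (h' : x - algebraMap F[X] B r' ∈ q') :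
        q ≠ q' := by
      rintro rfl
      have : q.LiesOver p := ((hmem q).1 hq).2
      refine hr (Ideal.Quotient.eq.2 ?_)
      rw [Ideal.over_def q p, Ideal.under_def, Ideal.mem_comap, map_sub]
      simpa using q.sub_mem h' h
    obtain ⟨r₁, rfl, q₁, hq₁, hx₁⟩ := hex T₁ hT₁
    obtain ⟨r₂, rfl, q₂, hq₂, hx₂⟩ := hex T₂ (by rw [hsol]; simp)
    obtain ⟨r₃, rfl, q₃, hq₃, hx₃⟩ := hex T₃ (by rw [hsol]; simp)
    exact Finset.two_lt_card.2 ⟨q₁, hq₁, q₂, hq₂, q₃, hq₃, hne h₁ hq₁ hx₁ hx₂, hne h₂ hq₁ hx₁ hx₃,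
      hne h₃ hq₂ hx₂ hx₃⟩
  · have hirr : Irreducible ((minpoly F[X] x).map (Ideal.Quotient.mk p)) := by
      let : Field (F[X] ⧸ p) := Ideal.Quotient.field p
      have hdeg : ((minpoly F[X] x).map (Ideal.Quotient.mk p)).natDegree = 3 := by
        rw [hminx, hmonic.natDegree_map, natDegree_stdCubic]
      refine irreducible_of_degree_le_three_of_not_isRoot (by rw [hdeg]; decide) fun T hT => ?_
      obtain ⟨r, rfl⟩ := Ideal.Quotient.mk_surjective T
      rw [IsRoot, hminx, eval_map_apply, Ideal.Quotient.eq_zero_iff_mem] at hT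
      have := eval_stdCubic_mem_iff.1 hT
      rw [hempty] at this
      exact this
    have h3f := natDegree_minpoly_le_inertiaDeg x p hirr ((hmem q).1 hq)
    rw [hminx, natDegree_stdCubic] at h3f
    obtain ⟨h1, h2⟩ := map_pair_eq_of_three_le_mul hsum he hf hq
      (h3f.trans (Nat.le_mul_of_pos_left _ (he q hq)))
    have he1 : q.ramificationIdx F[X] = 1 := by
      have := he q hq
      nlinarith
    rw [h2, he1, show q.inertiaDeg F[X] = 3 by simpa [he1] using h1]

end Signature

end ShanksCubic
-- The classification
theorem mainTheorem9 {F : Type*} [Field F] [Finite F] (hF : 5 ≤ ringChar F)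
    (A : F[X])
    (hstd : ShanksCubic.IsStandardForm (ShanksCubic.coeffA A) (ShanksCubic.coeffB A))
    {K : Type*} [Field K] [Algebra F[X] K] [Algebra (RatFunc F) K]
    [IsScalarTower F[X] (RatFunc F) K]
    (θ : K) (hgen : IntermediateField.adjoin (RatFunc F) {θ} = ⊤)
    (hmin : minpoly (RatFunc F) θ =
      (ShanksCubic.stdCubic A).map (algebraMap F[X] (RatFunc F)))
    (P : F[X]) (hP : Irreducible P) :
    let a := ShanksCubic.coeffA A
    let b := ShanksCubic.coeffB A
    let D := (ShanksCubic.stdCubic A).discr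
    -- the four cases
    let split₁ : Prop := emultiplicity P a = 0 ∧ 0 < emultiplicity P b ∧
      (∃ S : F[X], P ∣ S ^ 2 - a)
    let split₂ : Prop := emultiplicity P a = 0 ∧ emultiplicity P b = 0 ∧
      Even (emultiplicity P D) ∧ (ShanksCubic.solutionsMod P a b).ncard = 3
    let inert : Prop := emultiplicity P a = 0 ∧ emultiplicity P b = 0 ∧
      Even (emultiplicity P D) ∧ ShanksCubic.solutionsMod P a b = ∅
    let ramified : Prop := P ∣ a ∧ P ∣ b
    D = (A ^ 2 + 3 * A + 9) ^ 2 ∧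
    (ShanksCubic.HasSignatureAt K P {(1, 1), (1, 1), (1, 1)} ↔ split₁ ∨ split₂) ∧
    (ShanksCubic.HasSignatureAt K P {(1, 3)} ↔ inert) ∧
    (ShanksCubic.HasSignatureAt K P {(3, 1)} ↔ ramified) ∧
    (split₁ ∨ split₂ ∨ inert ∨ ramified) := by
  intro a b D split₁ split₂ inert ramified
  have hchar (n : ℕ) (h0 : 0 < n) (h5 : n < 5) : (n : F) ≠ 0 := fun h =>
    absurd (Nat.le_of_dvd h0 ((ringChar.spec F n).1 h)) (by omega)
  have h2 : (2 : F) ≠ 0 := by exact_mod_cast hchar 2 (by norm_num) (by norm_num)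
  have h3 : (3 : F) ≠ 0 := by exact_mod_cast hchar 3 (by norm_num) (by norm_num)
  have hD : D = (A ^ 2 + 3 * A + 9) ^ 2 := ShanksCubic.discr_stdCubic h3 A
  obtain ⟨hram, hsplit, hinert⟩ := ShanksCubic.hasSignatureAt_cases K h3 hstd hgen hmin hP
  have huniq {m m'} (h : ShanksCubic.HasSignatureAt K P m)
      (h' : ShanksCubic.HasSignatureAt K P m') : m = m' := h.unique h'
  have hne₁ : ({(1, 1), (1, 1), (1, 1)} : Multiset (ℕ × ℕ)) ≠ {(1, 3)} := by decide
  have hne₂ : ({(1, 1), (1, 1), (1, 1)} : Multiset (ℕ × ℕ)) ≠ {(3, 1)} := by decide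
  have hne₃ : ({(1, 3)} : Multiset (ℕ × ℕ)) ≠ {(3, 1)} := by decide
  have ha : P ∣ a ↔ P ∣ A ^ 2 + 3 * A + 9 := ShanksCubic.dvd_coeffA_iff h3
  refine ⟨hD, ?_⟩
  by_cases hM : P ∣ A ^ 2 + 3 * A + 9
  · have hr : ramified := ⟨ha.2 hM, ShanksCubic.dvd_coeffB hM⟩
    have hv : emultiplicity P a ≠ 0 := emultiplicity_ne_zero.2 (ha.2 hM)
    have hn₁ : ¬ split₁ := fun h => hv h.1
    have hn₂ : ¬ split₂ := fun h => hv h.1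
    have hn₃ : ¬ inert := fun h => hv h.1
    have hs := hram hM
    exact ⟨⟨fun h => absurd (huniq h hs) hne₂, fun h => h.elim (absurd · hn₁) (absurd · hn₂)⟩,
      ⟨fun h => absurd (huniq h hs) hne₃, fun h => absurd h hn₃⟩, iff_of_true hs hr,
      Or.inr (Or.inr (Or.inr hr))⟩
  have hr : ¬ ramified := fun h => hM (ha.1 h.1)
  have hv : emultiplicity P a = 0 := emultiplicity_eq_zero.2 fun h => hM (ha.1 h)
  -- When P ∤ M the valuation of D = M² is 0, so the parity condition is automatic.
  have hDv : Even (emultiplicity P D) := by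
    rw [hD, emultiplicity_eq_zero.2 fun h => hM (hP.prime.dvd_of_dvd_pow h)]
    exact Even.zero
  rcases Set.eq_empty_or_nonempty (ShanksCubic.solutionsMod P a b) with hempty | hne
  · have hb : emultiplicity P b = 0 := emultiplicity_eq_zero.2 fun h => by
      have : (0 : F[X] ⧸ Ideal.span {P}) ∈ ShanksCubic.solutionsMod P a b := by
        simp [ShanksCubic.solutionsMod, Ideal.Quotient.eq_zero_iff_mem,
          Ideal.mem_span_singleton, h]
      rw [hempty] at this
      exact this
    have hi : inert := ⟨hv, hb, hDv, hempty⟩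
    have hn₁ : ¬ split₁ := fun h => h.2.1.ne' hb
    have hn₂ : ¬ split₂ := fun h => by simpa [hempty] using h.2.2.2
    have hs := hinert hempty
    exact ⟨⟨fun h => absurd (huniq h hs) hne₁, fun h => h.elim (absurd · hn₁) (absurd · hn₂)⟩,
      iff_of_true hs hi, ⟨fun h => absurd (huniq hs h) hne₃, fun h => absurd h hr⟩,
      Or.inr (Or.inr (Or.inl hi))⟩
  · have hn₃ : ¬ inert := fun h => hne.ne_empty h.2.2.2
    have hs := hsplit hM hne
    have hsp : split₁ ∨ split₂ := by
      by_cases hb : P ∣ b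
      · exact Or.inl ⟨hv, emultiplicity_pos_of_dvd hb,
          ShanksCubic.exists_dvd_sq_sub_coeffA h2 h3 hP hM hb⟩
      · refine Or.inr ⟨hv, emultiplicity_eq_zero.2 hb, hDv, ?_⟩
        obtain ⟨T, hT⟩ := hne
        obtain ⟨T₂, T₃, h₁, h₂, h₃, hsol⟩ := ShanksCubic.solutionsMod_eq_of_mem h3 hP hM hT
        exact Set.ncard_eq_three.2 ⟨T, T₂, T₃, h₁, h₂, h₃, hsol⟩
    exact ⟨iff_of_true hs hsp, ⟨fun h => absurd (huniq hs h) hne₁, fun h => absurd h hn₃⟩,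
      ⟨fun h => absurd (huniq hs h) hne₂, fun h => absurd h hr⟩,
      hsp.imp_right Or.inl⟩
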